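/- Let $n\ge 1$ and let $\alpha_1,\dots,\alpha_n$ be the simple roots of the root system of type $\mathbb{A}_n$. Identify the root lattice with $\mathbb{Z}^n$ by sending $\alpha_i$ to the standard basis vector $e_i$, so that the positive roots are $\Phi^+=\{e_i+e_{i+1}+\cdots+e_j : 1\le i\le j\le n\}$. Put $\Phi^{\mathrm{clus}}=\Phi^+\cup\{-e_1,\dots,-e_n\}$ and $\Phi=\Phi^+\cup(-\Phi^+)$, and define the polytopes in $\mathbb{R}^n$ $$C(\mathbb{A}_n)=\mathrm{conv}(\Phi),\qquad C^{\mathrm{clus}}(\mathbb{A}_n)=\mathrm{conv}(\Phi^{\mathrm{clus}}),\qquad C^{+}(\mathbb{A}_n)=\mathrm{conv}(\Phi^+\cup\{0\}).$$ Let $\mathrm{vol}$ denote the normalised (integral) volume on $\mathbb{R}^n$, that is, $n!$ times Lebesgue measure, and let $C_m$ denote the $m$-th Catalan number ($C_0=1$, $C_{m+1}=\sum_{i=0}^{m}C_iC_{m-i}$). Then $$\mathrm{vol}\,C(\mathbb{A}_n)=\binom{2n}{n}=(n+1)C_n,\qquad \mathrm{vol}\,C^{\mathrm{clus}}(\mathbb{A}_n)=\frac{1}{n+2}\binom{2n+2}{n+1}=C_{n+1},\qquad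 \mathrm{vol}\,C^{+}(\mathbb{A}_n)=\frac{1}{n+1}\binom{2n}{n}=C_n.$$ -/

import Mathlib

open MeasureTheory
open scoped ENNReal Nat

namespace RootPolytopeA

/-- The root `α_i + ⋯ + α_j` of type `A_n`, written in coordinates with respect to the simple
roots `α_0, …, α_{n-1}`: the indicator vector of the interval `[i, j]`. -/
def intervalRoot {n : ℕ} (i j : Fin n) : Fin n → ℝ :=
  fun k => if i ≤ k ∧ k ≤ j then 1 else 0

/-- The set `Φ⁺` of positive roots of type `A_n`. -/
def positiveRoots (n : ℕ) : Set (Fin n → ℝ) :=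
  {v | ∃ i j : Fin n, i ≤ j ∧ v = intervalRoot i j}

/-- The set `Φ^clus` of almost positive roots: the positive roots and the negative simple
roots. -/
def almostPositiveRoots (n : ℕ) : Set (Fin n → ℝ) :=
  positiveRoots n ∪ {v | ∃ i : Fin n, v = -Pi.single i 1}

/-- The set `Φ` of all roots of type `A_n`. -/
def roots (n : ℕ) : Set (Fin n → ℝ) :=
  positiveRoots n ∪ {v | -v ∈ positiveRoots n}

/-- The polytope `C(A_n)`, the convex hull of all roots. -/
def polytopeC (n : ℕ) : Set (Fin n → ℝ) :=
  convexHull ℝ (roots n)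

/-- The polytope `C^clus(A_n)`, the convex hull of the almost positive roots. -/
def polytopeCclus (n : ℕ) : Set (Fin n → ℝ) :=
  convexHull ℝ (almostPositiveRoots n)

/-- The polytope `C⁺(A_n)`, the convex hull of the origin and the positive roots. -/
def polytopeCplus (n : ℕ) : Set (Fin n → ℝ) :=
  convexHull ℝ (insert 0 (positiveRoots n))

/-- The integral (normalised) volume on `ℝⁿ`: `n!` times Lebesgue measure, so that a simplex
spanned by the origin and a basis of `ℤⁿ` has volume `1`. -/
noncomputable def integralVolume {n : ℕ} (S : Set (Fin n → ℝ)) : ℝ≥0∞ :=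
  (n ! : ℝ≥0∞) * volume S

end RootPolytopeA

/-!
Let the ascent of `x` be the sum of the positive increments of the walk `0, x₁, …, xₙ, 0`. Abel
summation, with a linear functional represented by its partial sums, shows that `C` is the set where
the ascent is at most `1`, that `C⁺` is the part of `C` in the positive orthant, and that `C^clus`
is the set where the ascent of `x⁺` plus the sum of the entries of `x⁻` is at most `1`.

For a nonnegative function `g` homogeneous of degree one, `n!` times the volume of `{g ≤ 1}` is the
integral of `exp (-g)`. For the ascent this integral can be computed one coordinate at a time: up to
boundary terms a step applies the operator `F ↦ ∫₀^∞ exp (-(b - a)⁺) F(b) db`, which sends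
`aᵏ / k!` to `∑_{j ≤ k + 1} aʲ / j!` and hence acts on coefficients by tail sums, as in Pascal's
triangle. For `C` the coefficients are binomial, for `C⁺` and `C^clus` they are ballot numbers; the
constant term, reached at `a = 0`, is the normalised volume. A negative coordinate contributes the
factor `exp (-xᵢ⁻)`, which integrates to `1`, so for `C^clus` it acts as a point mass at `0`.
-/

namespace RootPolytopeA

open Set

section Sublinear

variable {E : Type*} [AddCommGroup E] [Module ℝ E]

/-- A sublinear functional: subadditive and positively homogeneous. The polytopes below are cut out
by inequalities `g x ≤ 1` with `g` sublinear. -/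
structure IsSublinear (g : E → ℝ) : Prop where
  map_add_le : ∀ x y, g (x + y) ≤ g x + g y
  map_smul : ∀ t : ℝ, 0 ≤ t → ∀ x, g (t • x) = t * g x

lemma IsSublinear.convex_setOf_le_one {g : E → ℝ} (hg : IsSublinear g) :
    Convex ℝ {x | g x ≤ 1} := by
  intro x hx y hy s t hs ht hst
  calc g (s • x + t • y) ≤ s * g x + t * g y := by
        simpa only [hg.map_smul s hs, hg.map_smul t ht] using hg.map_add_le (s • x) (t • y)
    _ ≤ s * 1 + t * 1 := by gcongr <;> assumption
    _ = 1 := by rw [mul_one, mul_one, hst]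

lemma zero_mem_convexHull_of_neg_mem {V : Set E} {v : E} (hv : v ∈ V) (hnv : -v ∈ V) :
    0 ∈ convexHull ℝ V := by
  rw [← midpoint_self_neg ℝ v]
  exact (convex_convexHull ℝ V).midpoint_mem (subset_convexHull ℝ V hv) (subset_convexHull ℝ V hnv)

/-- By `hdual`, no linear functional separates a point of `K` with `g x ≤ 1` from
`convexHull ℝ V`. -/
lemma convexHull_eq_inter_setOf_le_one [TopologicalSpace E] [IsTopologicalAddGroup E]
    [ContinuousSMul ℝ E] [LocallyConvexSpace ℝ E] [T2Space E] {V K : Set E} {g : E → ℝ}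
    (hV : V.Finite) (hV0 : 0 ∈ convexHull ℝ V) (hK : Convex ℝ K) (hVK : V ⊆ K)
    (hg : IsSublinear g) (hgV : ∀ v ∈ V, g v ≤ 1)
    (hdual : ∀ f : E →ₗ[ℝ] ℝ, ∀ M : ℝ, 0 ≤ M → (∀ v ∈ V, f v ≤ M) → ∀ x ∈ K, f x ≤ M * g x) :
    convexHull ℝ V = K ∩ {x | g x ≤ 1} := by
  refine Subset.antisymm
    (convexHull_min (subset_inter hVK hgV) (hK.inter hg.convex_setOf_le_one)) ?_
  rintro x ⟨hxK, hx : g x ≤ 1⟩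
  by_contra hxV
  obtain ⟨f, M, hfM, hMx⟩ :=
    geometric_hahn_banach_closed_point (convex_convexHull ℝ V) (hV.isClosed_convexHull ℝ) hxV
  have hM : 0 ≤ M := by simpa using (hfM 0 hV0).le
  have hfx : f x ≤ M * g x :=
    hdual f.toLinearMap M hM (fun v hv => (hfM v (subset_convexHull ℝ V hv)).le) x hxK
  exact hMx.not_ge (hfx.trans (mul_le_of_le_one_right hM hx))

end Sublinear

section Ascent

lemma posPart_add_le {α : Type*} [Lattice α] [AddCommGroup α] [IsOrderedAddMonoid α] (a b : α) :
    (a + b)⁺ ≤ a⁺ + b⁺ :=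
  sup_le (add_le_add (le_posPart a) (le_posPart b))
    (add_nonneg (posPart_nonneg a) (posPart_nonneg b))

lemma posPart_smul_of_nonneg {ι : Type*} {t : ℝ} (ht : 0 ≤ t) (x : ι → ℝ) : (t • x)⁺ = t • x⁺ := by
  ext i
  simp [posPart_def, mul_max_of_nonneg _ _ ht]

lemma negPart_smul_of_nonneg {ι : Type*} {t : ℝ} (ht : 0 ≤ t) (x : ι → ℝ) : (t • x)⁻ = t • x⁻ := by
  rw [← posPart_neg, ← smul_neg, posPart_smul_of_nonneg ht, posPart_neg]

/-- The total ascent of the walk `a, x 0, …, x (n - 1), 0`, i.e. the sum of its positive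
increments. -/
def ascent : {n : ℕ} → ℝ → (Fin n → ℝ) → ℝ
  | 0, a, _ => a⁻
  | _ + 1, a, x => (x 0 - a)⁺ + ascent (x 0) (Fin.tail x)

variable {n : ℕ}

@[simp]
lemma ascent_fin_zero (a : ℝ) (x : Fin 0 → ℝ) : ascent a x = a⁻ := rfl

lemma ascent_succ (a : ℝ) (x : Fin (n + 1) → ℝ) :
    ascent a x = (x 0 - a)⁺ + ascent (x 0) (Fin.tail x) := rfl

@[simp]
lemma ascent_cons (a b : ℝ) (x : Fin n → ℝ) :
    ascent a (Fin.cons b x : Fin (n + 1) → ℝ) = (b - a)⁺ + ascent b x := by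
  simp [ascent_succ]

lemma continuous_ascent : Continuous fun p : ℝ × (Fin n → ℝ) => ascent p.1 p.2 := by
  induction n with
  | zero => simp only [ascent_fin_zero]; fun_prop
  | succ n ih =>
    have htail : Continuous fun p : ℝ × (Fin (n + 1) → ℝ) => ascent (p.2 0) (Fin.tail p.2) :=
      ih.comp (f := fun p : ℝ × (Fin (n + 1) → ℝ) => (p.2 0, Fin.tail p.2))
        (by unfold Fin.tail; fun_prop)
    simp only [ascent_succ]
    fun_prop

lemma measurable_ascent (a : ℝ) : Measurable (ascent a : (Fin n → ℝ) → ℝ) :=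
  (continuous_ascent.comp (by fun_prop : Continuous fun x : Fin n → ℝ => (a, x))).measurable

lemma ascent_nonneg (a : ℝ) (x : Fin n → ℝ) : 0 ≤ ascent a x := by
  induction n generalizing a with
  | zero => exact negPart_nonneg a
  | succ n ih => exact add_nonneg (posPart_nonneg _) (ih _ _)

lemma ascent_add_le (a b : ℝ) (x y : Fin n → ℝ) :
    ascent (a + b) (x + y) ≤ ascent a x + ascent b y := by
  induction n generalizing a b with
  | zero => simpa [← posPart_neg, add_comm] using posPart_add_le (-b) (-a)
  | succ n ih =>
    have hhead := posPart_add_le (x 0 - a) (y 0 - b)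
    rw [sub_add_sub_comm] at hhead
    have htail := ih (x 0) (y 0) (Fin.tail x) (Fin.tail y)
    simp only [ascent_succ]
    linarith!

lemma ascent_smul {t : ℝ} (ht : 0 ≤ t) (a : ℝ) (x : Fin n → ℝ) :
    ascent (t * a) (t • x) = t * ascent a x := by
  induction n generalizing a with
  | zero => simp [negPart_def, mul_max_of_nonneg _ _ ht]
  | succ n ih =>
    have hhead : (t * x 0 - t * a)⁺ = t * (x 0 - a)⁺ := by
      simp [posPart_def, mul_max_of_nonneg _ _ ht, mul_sub]
    rw [ascent_succ, ascent_succ, mul_add, ← hhead, ← ih]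
    rfl

lemma isSublinear_ascent_zero : IsSublinear (ascent 0 : (Fin n → ℝ) → ℝ) where
  map_add_le x y := by simpa using ascent_add_le 0 0 x y
  map_smul t ht x := by simpa using ascent_smul ht 0 x

/-- Negation turns the ascents of the walk into descents, and the two differ by the net
increment `-a`. -/
lemma ascent_neg (a : ℝ) (x : Fin n → ℝ) : ascent (-a) (-x) = ascent a x + a := by
  induction n generalizing a with
  | zero =>
    rw [ascent_fin_zero, ascent_fin_zero, negPart_neg]
    linarith [posPart_sub_negPart a]
  | succ n ih =>
    have hhead : (-x 0 - -a)⁺ = (x 0 - a)⁺ - (x 0 - a) := by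
      simp only [posPart_def]
      grind
    have htail : ascent (-x 0) (Fin.tail (-x)) = ascent (x 0) (Fin.tail x) + x 0 :=
      ih (x 0) (Fin.tail x)
    rw [ascent_succ, ascent_succ, Pi.neg_apply, htail, hhead]
    ring

lemma ascent_eq_ascent_posPart_add_ascent_negPart (a : ℝ) (x : Fin n → ℝ) :
    ascent a x = ascent a⁺ x⁺ + ascent a⁻ x⁻ + a⁻ := by
  induction n generalizing a with
  | zero => simp
  | succ n ih =>
    have hhead : (x 0 - a)⁺ + (x 0)⁻ = ((x 0)⁺ - a⁺)⁺ + ((x 0)⁻ - a⁻)⁺ + a⁻ := by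
      simp only [posPart_def, negPart_def]
      grind
    have htail : ascent (x 0) (Fin.tail x) =
        ascent (x 0)⁺ (Fin.tail x⁺) + ascent (x 0)⁻ (Fin.tail x⁻) + (x 0)⁻ := ih (x 0) (Fin.tail x)
    simp only [ascent_succ, Pi.posPart_apply, Pi.negPart_apply]
    linarith

lemma ascent_le_sum {a : ℝ} (ha : 0 ≤ a) {x : Fin n → ℝ} (hx : 0 ≤ x) :
    ascent a x ≤ ∑ i, x i := by
  induction n generalizing a with
  | zero => simp [ha]
  | succ n ih =>
    have hhead : (x 0 - a)⁺ ≤ x 0 := by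
      rw [posPart_def]
      exact sup_le (by linarith) (hx 0)
    rw [ascent_succ, Fin.sum_univ_succ]
    exact add_le_add hhead (ih (hx 0) fun i => hx i.succ)

lemma ascent_zero_right {a : ℝ} (ha : 0 ≤ a) : ascent a (0 : Fin n → ℝ) = 0 :=
  le_antisymm (by simpa using ascent_le_sum ha (x := (0 : Fin n → ℝ)) le_rfl) (ascent_nonneg a 0)

end Ascent

section IntervalRoot

variable {n : ℕ}

lemma intervalRoot_nonneg (i j : Fin n) : 0 ≤ intervalRoot i j := by
  intro k
  simp only [intervalRoot, Pi.zero_apply]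
  split_ifs <;> norm_num

lemma intervalRoot_self (i : Fin n) : intervalRoot i i = Pi.single i 1 := by
  ext k
  simp [intervalRoot, Pi.single_apply, ← le_antisymm_iff, eq_comm]

lemma intervalRoot_zero_zero : intervalRoot (0 : Fin (n + 1)) 0 = Fin.cons 1 0 := by
  ext k
  cases k using Fin.cases <;> simp [intervalRoot]

lemma intervalRoot_zero_succ (j : Fin (n + 1)) :
    intervalRoot 0 j.succ = Fin.cons 1 (intervalRoot 0 j) := by
  ext k
  cases k using Fin.cases <;> simp [intervalRoot]

lemma intervalRoot_succ_succ (i j : Fin n) :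
    intervalRoot i.succ j.succ = Fin.cons 0 (intervalRoot i j) := by
  ext k
  cases k using Fin.cases <;> simp [intervalRoot]

lemma ascent_one_intervalRoot_zero (j : Fin (n + 1)) : ascent 1 (intervalRoot 0 j) = 0 := by
  induction n with
  | zero =>
    rw [Fin.fin_one_eq_zero j, intervalRoot_zero_zero, ascent_cons, ascent_zero_right zero_le_one]
    simp
  | succ n ih =>
    cases j using Fin.cases with
    | zero => simp [intervalRoot_zero_zero, ascent_zero_right]
    | succ j => simp [intervalRoot_zero_succ, ih]

lemma ascent_intervalRoot {i j : Fin n} (hij : i ≤ j) : ascent 0 (intervalRoot i j) = 1 := by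
  induction n with
  | zero => exact i.elim0
  | succ n ih =>
    cases i using Fin.cases with
    | zero =>
      have hone : intervalRoot 0 j 0 = 1 := by simp [intervalRoot]
      have htail := ascent_one_intervalRoot_zero j
      rw [ascent_succ, hone, sub_self, posPart_zero, zero_add] at htail
      rw [ascent_succ, hone, htail, sub_zero, add_zero, posPart_of_nonneg zero_le_one]
    | succ i =>
      obtain ⟨j, rfl⟩ := Fin.exists_succ_eq.2 ((Fin.succ_pos i).trans_le hij).ne'
      simp [intervalRoot_succ_succ, ih (Fin.succ_le_succ_iff.1 hij)]

/-- The indicator of the first `i` coordinates. The interval roots are the differences of such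
vectors, so a linear functional `f` is determined by its partial sums `f (initialOnes i)`. -/
def initialOnes (i : Fin (n + 1)) : Fin n → ℝ :=
  fun k => if k.castSucc < i then 1 else 0

lemma intervalRoot_eq_initialOnes_sub {i j : Fin n} (hij : i ≤ j) :
    intervalRoot i j = initialOnes j.succ - initialOnes i.castSucc := by
  ext k
  simp only [intervalRoot, initialOnes, Pi.sub_apply, Fin.castSucc_lt_succ_iff,
    Fin.castSucc_lt_castSucc_iff]
  grind

/-- Here `S` plays the role of the partial sums of the coefficients of a linear functional, and `m`
bounds the first partial sums separately so that the induction goes through. -/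
lemma sum_sub_mul_le_ascent {S : Fin (n + 1) → ℝ} {m M a : ℝ} {x : Fin n → ℝ} (hmM : m ≤ M)
    (hm : ∀ j, S j - S 0 ≤ m) (hM : ∀ i j, i ≤ j → S j - S i ≤ M) (ha : 0 ≤ a) (hx : 0 ≤ x) :
    ∑ k, (S k.succ - S k.castSucc) * x k ≤ M * ascent a x + m * a := by
  have hm0 : 0 ≤ m := by simpa using hm 0
  induction n generalizing m a with
  | zero => simpa [ha] using mul_nonneg hm0 ha
  | succ n ih =>
    set d : ℝ := S 1 - S 0
    set m' : ℝ := min M (m - d)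
    have hx0 : 0 ≤ x 0 := hx 0
    have htail : ∑ k : Fin n, (S k.succ.succ - S k.castSucc.succ) * x k.succ ≤
        M * ascent (x 0) (Fin.tail x) + m' * x 0 := by
      have hm'S : ∀ j : Fin (n + 1), S j.succ - S 1 ≤ m' := fun j =>
        le_min (hM _ _ (Fin.succ_le_succ_iff.2 (Fin.zero_le j))) (by linarith [hm j.succ])
      exact ih (S := fun i => S i.succ) (min_le_left _ _) hm'S
        (fun i j hij => hM _ _ (Fin.succ_le_succ_iff.2 hij)) hx0 (fun i => hx i.succ)
        (by simpa using hm'S 0)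
    have hhead : (d + m') * x 0 ≤ M * (x 0 - a)⁺ + m * a := by
      have hdm : d + m' ≤ m := by linarith [min_le_right M (m - d)]
      have hincr : x 0 - a ≤ (x 0 - a)⁺ := le_posPart _
      calc (d + m') * x 0 ≤ m * x 0 := by gcongr
        _ ≤ m * ((x 0 - a)⁺ + a) := by gcongr; linarith
        _ = m * (x 0 - a)⁺ + m * a := mul_add _ _ _
        _ ≤ M * (x 0 - a)⁺ + m * a := by gcongr
    rw [Fin.sum_univ_succ, ascent_succ]
    simp only [Fin.succ_zero_eq_one, Fin.castSucc_zero, ← Fin.succ_castSucc]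
    linarith

lemma linearMap_apply_le_mul_ascent {f : (Fin n → ℝ) →ₗ[ℝ] ℝ} {M : ℝ} (hM : 0 ≤ M)
    (hf : ∀ v ∈ positiveRoots n, f v ≤ M) {x : Fin n → ℝ} (hx : 0 ≤ x) :
    f x ≤ M * ascent 0 x := by
  have hpartial : ∀ i j : Fin (n + 1), i ≤ j → f (initialOnes j) - f (initialOnes i) ≤ M := by
    intro i j hij
    obtain rfl | hlt := hij.eq_or_lt
    · simpa using hM
    obtain ⟨i, rfl⟩ := Fin.exists_castSucc_eq.2 (hlt.trans_le (Fin.le_last j)).ne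
    obtain ⟨j, rfl⟩ := Fin.exists_succ_eq.2 ((Fin.zero_le _).trans_lt hlt).ne'
    have hij' : i ≤ j := Fin.castSucc_lt_succ_iff.1 hlt
    rw [← map_sub, ← intervalRoot_eq_initialOnes_sub hij']
    exact hf _ ⟨i, j, hij', rfl⟩
  have hcoeff : ∀ k : Fin n,
      f (Pi.single k 1) = f (initialOnes k.succ) - f (initialOnes k.castSucc) := fun k => by
    rw [← map_sub, ← intervalRoot_eq_initialOnes_sub le_rfl, intervalRoot_self]
  calc f x = ∑ k, (f (initialOnes k.succ) - f (initialOnes k.castSucc)) * x k := by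
        conv_lhs => rw [pi_eq_sum_univ' x]
        simp only [map_sum, map_smul, smul_eq_mul, hcoeff, mul_comm (x _)]
    _ ≤ M * ascent 0 x + M * 0 :=
        sum_sub_mul_le_ascent (S := fun i => f (initialOnes i)) le_rfl
          (fun j => hpartial 0 j (Fin.zero_le j)) hpartial le_rfl hx
    _ = M * ascent 0 x := by ring

end IntervalRoot

section Polytopes

variable {n : ℕ}

lemma ascent_zero_neg (x : Fin n → ℝ) : ascent 0 (-x) = ascent 0 x := by
  simpa using ascent_neg 0 x

lemma ascent_zero_sub_le (p : Fin n → ℝ) {r : Fin n → ℝ} (hr : 0 ≤ r) :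
    ascent 0 (p - r) ≤ ascent 0 p + ∑ i, r i :=
  calc ascent 0 (p - r) ≤ ascent 0 p + ascent 0 (-r) := by
        simpa [sub_eq_add_neg] using ascent_add_le 0 0 p (-r)
    _ = ascent 0 p + ascent 0 r := by rw [ascent_zero_neg]
    _ ≤ ascent 0 p + ∑ i, r i := by gcongr; exact ascent_le_sum le_rfl hr

/-- The gauge of the polytope `C^clus`: the ascent of the positive part plus the total mass of the
negative part. -/
def clusterGauge (x : Fin n → ℝ) : ℝ := ascent 0 x⁺ + ∑ i, x⁻ i

lemma measurable_clusterGauge : Measurable (clusterGauge : (Fin n → ℝ) → ℝ) := by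
  have hpos : Measurable fun x : Fin n → ℝ => x⁺ :=
    measurable_pi_lambda _ fun i => by simp only [Pi.posPart_apply]; fun_prop
  refine ((measurable_ascent 0).comp hpos).add ?_
  simp only [Pi.negPart_apply]
  fun_prop

lemma clusterGauge_nonneg (x : Fin n → ℝ) : 0 ≤ clusterGauge x :=
  add_nonneg (ascent_nonneg _ _) (Finset.sum_nonneg fun i _ => negPart_nonneg x i)

lemma clusterGauge_of_nonneg {x : Fin n → ℝ} (hx : 0 ≤ x) : clusterGauge x = ascent 0 x := by
  rw [clusterGauge, posPart_of_nonneg hx, negPart_of_nonneg hx]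
  simp

lemma clusterGauge_neg_of_nonneg {x : Fin n → ℝ} (hx : 0 ≤ x) : clusterGauge (-x) = ∑ i, x i := by
  rw [clusterGauge, posPart_neg, negPart_neg, posPart_of_nonneg hx, negPart_of_nonneg hx,
    ascent_zero_right le_rfl, zero_add]

lemma isSublinear_clusterGauge : IsSublinear (clusterGauge : (Fin n → ℝ) → ℝ) where
  map_add_le x y := by
    -- `r` is the mass cancelled between the positive part of one summand and the negative part of
    -- the other; removing it from `x⁺ + y⁺` costs at most what `(x + y)⁻` saves.
    set r : Fin n → ℝ := x⁺ + y⁺ - (x + y)⁺ with hr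
    have hr0 : 0 ≤ r := sub_nonneg.2 (posPart_add_le x y)
    have hpos : (x + y)⁺ = x⁺ + y⁺ - r := by simp [hr]
    have hneg : x⁻ + y⁻ = (x + y)⁻ + r := by
      ext i
      have hxy := posPart_sub_negPart (x i + y i)
      have hx := posPart_sub_negPart (x i)
      have hy := posPart_sub_negPart (y i)
      simp only [hr, Pi.add_apply, Pi.sub_apply, Pi.posPart_apply, Pi.negPart_apply]
      linarith
    calc clusterGauge (x + y) ≤ ascent 0 (x⁺ + y⁺) + ∑ i, r i + ∑ i, (x + y)⁻ i := by
          rw [clusterGauge, hpos]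
          gcongr
          exact ascent_zero_sub_le _ hr0
      _ = ascent 0 (x⁺ + y⁺) + ∑ i, (x⁻ + y⁻) i := by
          rw [hneg]
          simp only [Pi.add_apply, Finset.sum_add_distrib]
          ring
      _ ≤ ascent 0 x⁺ + ascent 0 y⁺ + ∑ i, (x⁻ + y⁻) i := by
          gcongr
          exact isSublinear_ascent_zero.map_add_le _ _
      _ = clusterGauge x + clusterGauge y := by
          simp only [clusterGauge, Pi.add_apply, Finset.sum_add_distrib]
          ring
  map_smul t ht x := by
    simp only [clusterGauge, posPart_smul_of_nonneg ht, negPart_smul_of_nonneg ht,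
      isSublinear_ascent_zero.map_smul t ht, Pi.smul_apply, smul_eq_mul, mul_add, Finset.mul_sum]

lemma finite_positiveRoots : (positiveRoots n).Finite :=
  (finite_range fun p : Fin n × Fin n => intervalRoot p.1 p.2).subset <| by
    rintro _ ⟨i, j, -, rfl⟩
    exact ⟨(i, j), rfl⟩

lemma single_mem_positiveRoots (i : Fin n) : Pi.single i 1 ∈ positiveRoots n :=
  ⟨i, i, le_rfl, (intervalRoot_self i).symm⟩

theorem polytopeCplus_eq_inter_setOf_ascent_le_one :
    polytopeCplus n = {x | 0 ≤ x} ∩ {x | ascent 0 x ≤ 1} := by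
  refine convexHull_eq_inter_setOf_le_one (finite_positiveRoots.insert 0)
    (subset_convexHull ℝ _ (mem_insert _ _)) (convex_Ici 0) ?_ isSublinear_ascent_zero ?_ ?_
  · rintro _ (rfl | ⟨i, j, -, rfl⟩)
    exacts [le_refl (0 : Fin n → ℝ), intervalRoot_nonneg i j]
  · rintro _ (rfl | ⟨i, j, hij, rfl⟩)
    exacts [(ascent_zero_right le_rfl).trans_le zero_le_one, (ascent_intervalRoot hij).le]
  · exact fun f M hM hf x hx =>
      linearMap_apply_le_mul_ascent hM (fun v hv => hf v (mem_insert_of_mem _ hv)) hx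

theorem polytopeC_eq_setOf_ascent_le_one [NeZero n] : polytopeC n = {x | ascent 0 x ≤ 1} := by
  have hfin : (roots n).Finite := finite_positiveRoots.union finite_positiveRoots.neg
  have hsimple : Pi.single 0 1 ∈ positiveRoots n := single_mem_positiveRoots 0
  rw [polytopeC, ← univ_inter {x : Fin n → ℝ | ascent 0 x ≤ 1}]
  refine convexHull_eq_inter_setOf_le_one hfin
    (zero_mem_convexHull_of_neg_mem (Or.inl hsimple) (Or.inr (by simpa using hsimple))) convex_univ
    (subset_univ _) isSublinear_ascent_zero ?_ ?_
  · rintro v (⟨i, j, hij, rfl⟩ | ⟨i, j, hij, hv⟩)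
    · exact (ascent_intervalRoot hij).le
    · rw [← ascent_zero_neg, hv]
      exact (ascent_intervalRoot hij).le
  · intro f M hM hf x _
    have hpos := linearMap_apply_le_mul_ascent hM (fun v hv => hf v (Or.inl hv)) (posPart_nonneg x)
    have hneg := linearMap_apply_le_mul_ascent (f := -f) hM
      (fun v hv => by simpa using hf (-v) (Or.inr (by simpa using hv))) (negPart_nonneg x)
    calc f x = f x⁺ + (-f) x⁻ := by
          rw [LinearMap.neg_apply, ← sub_eq_add_neg, ← map_sub, posPart_sub_negPart]
      _ ≤ M * (ascent 0 x⁺ + ascent 0 x⁻) := by linarith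
      _ = M * ascent 0 x := by
          rw [ascent_eq_ascent_posPart_add_ascent_negPart 0 x, posPart_zero, negPart_zero, add_zero]

theorem polytopeCclus_eq_setOf_clusterGauge_le_one [NeZero n] :
    polytopeCclus n = {x | clusterGauge x ≤ 1} := by
  have hfin : (almostPositiveRoots n).Finite := by
    refine finite_positiveRoots.union
      ((finite_range fun i : Fin n => (-Pi.single i 1 : Fin n → ℝ)).subset ?_)
    rintro _ ⟨i, rfl⟩
    exact ⟨i, rfl⟩
  rw [polytopeCclus, ← univ_inter {x : Fin n → ℝ | clusterGauge x ≤ 1}]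
  refine convexHull_eq_inter_setOf_le_one hfin
    (zero_mem_convexHull_of_neg_mem (Or.inl (single_mem_positiveRoots 0)) (Or.inr ⟨0, rfl⟩))
    convex_univ (subset_univ _) isSublinear_clusterGauge ?_ ?_
  · rintro _ (⟨i, j, hij, rfl⟩ | ⟨i, rfl⟩)
    · rw [clusterGauge_of_nonneg (intervalRoot_nonneg i j), ascent_intervalRoot hij]
    · rw [clusterGauge_neg_of_nonneg (Pi.single_nonneg.2 zero_le_one)]
      simp
  · intro f M hM hf x _
    have hpos := linearMap_apply_le_mul_ascent hM (fun v hv => hf v (Or.inl hv)) (posPart_nonneg x)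
    have hneg : (-f) x⁻ ≤ M * ∑ i, x⁻ i := by
      conv_lhs => rw [pi_eq_sum_univ' x⁻, map_sum]
      rw [Finset.mul_sum]
      refine Finset.sum_le_sum fun i _ => ?_
      have hi : (-f) (Pi.single i 1) ≤ M := by simpa using hf (-Pi.single i 1) (Or.inr ⟨i, rfl⟩)
      rw [map_smul, smul_eq_mul, mul_comm M]
      gcongr
      exact negPart_nonneg x i
    calc f x = f x⁺ + (-f) x⁻ := by
          rw [LinearMap.neg_apply, ← sub_eq_add_neg, ← map_sub, posPart_sub_negPart]
      _ ≤ M * clusterGauge x := by rw [clusterGauge]; linarith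

end Polytopes

section ExponentialIntegrals

open scoped Pointwise

/-- The weight `e⁻ᵗ` as an extended nonnegative real. -/
noncomputable def expNeg (t : ℝ) : ℝ≥0∞ := ENNReal.ofReal (Real.exp (-t))

/-- The divided power `tᵏ / k!` as an extended nonnegative real (truncated to `0` where it is
negative; it is used for `0 ≤ t` only). -/
noncomputable def dividedPow (k : ℕ) (t : ℝ) : ℝ≥0∞ := ENNReal.ofReal (t ^ k / k !)

@[simp]
lemma expNeg_zero : expNeg 0 = 1 := by simp [expNeg]

lemma expNeg_add (s t : ℝ) : expNeg (s + t) = expNeg s * expNeg t := by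
  rw [expNeg, neg_add, Real.exp_add, ENNReal.ofReal_mul (Real.exp_pos _).le, expNeg, expNeg]

lemma expNeg_sum {ι : Type*} (s : Finset ι) (f : ι → ℝ) :
    expNeg (∑ i ∈ s, f i) = ∏ i ∈ s, expNeg (f i) := by
  classical
  induction s using Finset.induction_on with
  | empty => simp
  | insert i s hi ih => rw [Finset.sum_insert hi, Finset.prod_insert hi, expNeg_add, ih]

@[fun_prop]
lemma measurable_expNeg : Measurable expNeg := by
  unfold expNeg
  fun_prop

@[fun_prop]
lemma measurable_dividedPow (k : ℕ) : Measurable (dividedPow k) := by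
  unfold dividedPow
  fun_prop

@[simp]
lemma dividedPow_zero_left (t : ℝ) : dividedPow 0 t = 1 := by simp [dividedPow]

lemma dividedPow_zero_right {k : ℕ} (hk : k ≠ 0) : dividedPow k 0 = 0 := by
  simp [dividedPow, hk]

lemma factorial_mul_dividedPow (k : ℕ) (t : ℝ) :
    (k ! : ℝ≥0∞) * dividedPow k t = ENNReal.ofReal (t ^ k) := by
  rw [dividedPow, ← ENNReal.ofReal_natCast, ← ENNReal.ofReal_mul (by positivity),
    mul_div_cancel₀ _ (by positivity)]

lemma setLIntegral_Ici_expNeg (c : ℝ) : ∫⁻ t in Ici c, expNeg t = expNeg c := by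
  simp only [expNeg]
  rw [setLIntegral_congr Ioi_ae_eq_Ici.symm, ← integral_exp_neg_Ioi c,
    ofReal_integral_eq_lintegral_ofReal (integrableOn_exp_neg_Ioi c)
      (Filter.Eventually.of_forall fun t => (Real.exp_pos _).le)]

lemma setLIntegral_Ioi_expNeg_mul_dividedPow (k : ℕ) :
    ∫⁻ t in Ioi 0, expNeg t * dividedPow k t = 1 := by
  have hk : (0 : ℝ) < k + 1 := by positivity
  have hfact : (k ! : ℝ≥0∞) ≠ 0 := by simp [Nat.factorial_ne_zero]
  have hgamma := Real.Gamma_nat_eq_factorial k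
  rw [Real.Gamma_eq_integral hk] at hgamma
  have hlintegral : ∫⁻ t in Ioi 0, expNeg t * ENNReal.ofReal (t ^ k) = k ! := by
    rw [← ENNReal.ofReal_natCast, ← hgamma, ofReal_integral_eq_lintegral_ofReal
      (Real.GammaIntegral_convergent hk) ((ae_restrict_iff' measurableSet_Ioi).2
        (Filter.Eventually.of_forall fun _ ht =>
          mul_nonneg (Real.exp_pos _).le (Real.rpow_nonneg (le_of_lt ht) _)))]
    refine setLIntegral_congr_fun measurableSet_Ioi fun t _ => ?_
    rw [expNeg, ← ENNReal.ofReal_mul (Real.exp_pos _).le, add_sub_cancel_right, Real.rpow_natCast]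
  simp only [← factorial_mul_dividedPow, mul_left_comm (expNeg _)] at hlintegral
  rw [lintegral_const_mul _ (by fun_prop)] at hlintegral
  exact (ENNReal.mul_eq_left hfact (ENNReal.natCast_ne_top _)).1 hlintegral

lemma lintegral_expNeg_comp {α : Type*} [MeasurableSpace α] (μ : Measure α) [SFinite μ] {g : α → ℝ}
    (hg : Measurable g) :
    ∫⁻ x, expNeg (g x) ∂μ = ∫⁻ t, expNeg t * μ {x | g x ≤ t} := by
  have hmeas : Measurable ({p : α × ℝ | g p.1 ≤ p.2}.indicator fun p => expNeg p.2) :=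
    Measurable.indicator (by fun_prop) (measurableSet_le (by fun_prop) (by fun_prop))
  calc ∫⁻ x, expNeg (g x) ∂μ = ∫⁻ x, (∫⁻ t, (Ici (g x)).indicator expNeg t) ∂μ := by
        simp only [lintegral_indicator measurableSet_Ici, setLIntegral_Ici_expNeg]
    _ = ∫⁻ t, ∫⁻ x, {x | g x ≤ t}.indicator (fun _ => expNeg t) x ∂μ :=
        lintegral_lintegral_swap hmeas.aemeasurable
    _ = ∫⁻ t, expNeg t * μ {x | g x ≤ t} := by
        simp only [lintegral_indicator_const (measurableSet_le hg measurable_const)]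

/-- By homogeneity `{g ≤ t}` is the dilation of `{g ≤ 1}` by `t`, so the layer-cake
formula for `e⁻ᵍ` becomes a Gamma integral. -/
lemma factorial_finrank_mul_addHaar_eq_lintegral_expNeg {E : Type*} [NormedAddCommGroup E]
    [NormedSpace ℝ E] [FiniteDimensional ℝ E] [MeasurableSpace E] [BorelSpace E] (μ : Measure E)
    [μ.IsAddHaarMeasure] {K : Set E} {g : E → ℝ} (hg : Measurable g) (hg0 : ∀ x ∈ K, 0 ≤ g x)
    (hK : ∀ t : ℝ, 0 < t → ∀ x ∈ K, t • x ∈ K)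
    (hsmul : ∀ t : ℝ, 0 < t → ∀ x, g (t • x) = t * g x) :
    (Module.finrank ℝ E)! * μ (K ∩ {x | g x ≤ 1}) = ∫⁻ x in K, expNeg (g x) ∂μ := by
  set d := Module.finrank ℝ E
  have hdilate : ∀ t : ℝ, 0 < t → {x | g x ≤ t} ∩ K = t • (K ∩ {x | g x ≤ 1}) := by
    intro t ht
    ext x
    have hKx : t⁻¹ • x ∈ K ↔ x ∈ K :=
      ⟨fun h => by simpa [smul_smul, ht.ne'] using hK t ht _ h, hK t⁻¹ (inv_pos.2 ht) x⟩
    rw [mem_smul_set_iff_inv_smul_mem₀ ht.ne', mem_inter_iff, mem_inter_iff, hKx, and_comm]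
    simp only [mem_ofPred_eq, hsmul _ (inv_pos.2 ht), inv_mul_le_iff₀ ht, mul_one]
  have hpos : ∀ t ∈ Ioi (0 : ℝ), expNeg t * μ.restrict K {x | g x ≤ t} =
      expNeg t * dividedPow d t * (d ! * μ (K ∩ {x | g x ≤ 1})) := by
    intro t ht
    rw [Measure.restrict_apply (measurableSet_le hg measurable_const), hdilate t ht,
      Measure.addHaar_smul_of_nonneg μ (le_of_lt ht), ← factorial_mul_dividedPow]
    ring
  have hneg : ∀ t ∈ Iio (0 : ℝ), expNeg t * μ.restrict K {x | g x ≤ t} = 0 := by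
    intro t ht
    have hempty : {x | g x ≤ t} ∩ K = ∅ :=
      eq_empty_of_forall_notMem fun x hx => (hx.1.trans_lt ht).not_ge (hg0 x hx.2)
    rw [Measure.restrict_apply (measurableSet_le hg measurable_const), hempty, measure_empty,
      mul_zero]
  rw [lintegral_expNeg_comp _ hg, ← lintegral_add_compl _ measurableSet_Ioi, compl_Ioi,
    setLIntegral_congr_fun measurableSet_Ioi hpos, lintegral_mul_const _ (by fun_prop),
    setLIntegral_Ioi_expNeg_mul_dividedPow, one_mul, setLIntegral_congr Iio_ae_eq_Iic.symm,
    setLIntegral_congr_fun measurableSet_Iio hneg, lintegral_zero, add_zero]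

lemma integralVolume_inter_eq_lintegral_expNeg {n : ℕ} {K : Set (Fin n → ℝ)} {g : (Fin n → ℝ) → ℝ}
    (hg : Measurable g) (hg0 : ∀ x ∈ K, 0 ≤ g x) (hK : ∀ t : ℝ, 0 < t → ∀ x ∈ K, t • x ∈ K)
    (hsmul : ∀ t : ℝ, 0 < t → ∀ x, g (t • x) = t * g x) :
    integralVolume (K ∩ {x | g x ≤ 1}) = ∫⁻ x in K, expNeg (g x) := by
  rw [← factorial_finrank_mul_addHaar_eq_lintegral_expNeg volume hg hg0 hK hsmul,
    Module.finrank_fin_fun, integralVolume]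

end ExponentialIntegrals

section AscentTransfer

/-- The operator `F ↦ (a ↦ ∫₀^∞ e^{-(b - a)⁺} F(b) db)`: it prepends one positive step to a walk
weighted by `exp (-ascent)`. -/
noncomputable def ascentTransfer (F : ℝ → ℝ≥0∞) (a : ℝ) : ℝ≥0∞ :=
  ∫⁻ b in Ioi 0, expNeg (b - a)⁺ * F b

lemma ascentTransfer_congr {F G : ℝ → ℝ≥0∞} (h : ∀ b, 0 < b → F b = G b) (a : ℝ) :
    ascentTransfer F a = ascentTransfer G a :=
  setLIntegral_congr_fun measurableSet_Ioi fun b hb => by rw [h b hb]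

lemma ascentTransfer_zero_right (F : ℝ → ℝ≥0∞) :
    ascentTransfer F 0 = ∫⁻ b in Ioi 0, expNeg b * F b :=
  setLIntegral_congr_fun measurableSet_Ioi fun b hb => by
    rw [sub_zero, posPart_of_nonneg (le_of_lt hb)]

lemma dividedPow_add {a s : ℝ} (ha : 0 ≤ a) (hs : 0 ≤ s) (k : ℕ) :
    dividedPow k (a + s) = ∑ j ∈ Finset.range (k + 1), dividedPow j a * dividedPow (k - j) s := by
  have hbinom : (a + s) ^ k / k ! =
      ∑ j ∈ Finset.range (k + 1), a ^ j / j ! * (s ^ (k - j) / (k - j)!) := by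
    rw [add_pow, Finset.sum_div]
    refine Finset.sum_congr rfl fun j hj => ?_
    rw [Nat.cast_choose ℝ (Finset.mem_range_succ_iff.1 hj)]
    field_simp
  simp only [dividedPow]
  rw [hbinom, ENNReal.ofReal_sum_of_nonneg fun j _ => by positivity]
  exact Finset.sum_congr rfl fun j _ => ENNReal.ofReal_mul (by positivity)

lemma setLIntegral_Ioc_dividedPow (k : ℕ) {a : ℝ} (ha : 0 ≤ a) :
    ∫⁻ b in Ioc 0 a, dividedPow k b = dividedPow (k + 1) a := by
  have hint : ∫ b in Ioc 0 a, b ^ k / k ! = a ^ (k + 1) / (k + 1)! := by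
    rw [← intervalIntegral.integral_of_le ha, intervalIntegral.integral_div, integral_pow,
      Nat.factorial_succ]
    push_cast
    field_simp
    simp
  rw [dividedPow, ← hint, ofReal_integral_eq_lintegral_ofReal]
  · rfl
  · exact (Continuous.integrableOn_Icc (by fun_prop)).mono_set Ioc_subset_Icc_self
  · exact (ae_restrict_iff' measurableSet_Ioc).2 (Filter.Eventually.of_forall fun b hb =>
      div_nonneg (pow_nonneg hb.1.le _) (by positivity))

lemma setLIntegral_Ioi_expNeg_sub_mul_dividedPow (k : ℕ) {a : ℝ} (ha : 0 ≤ a) :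
    ∫⁻ b in Ioi a, expNeg (b - a) * dividedPow k b =
      ∑ j ∈ Finset.range (k + 1), dividedPow j a := by
  have hshift := (measurePreserving_add_left volume a).setLIntegral_comp_preimage_emb
    (measurableEmbedding_addLeft a) (fun b => expNeg (b - a) * dividedPow k b) (Ioi a)
  rw [preimage_const_add_Ioi, sub_self] at hshift
  calc ∫⁻ b in Ioi a, expNeg (b - a) * dividedPow k b
      = ∫⁻ s in Ioi 0, ∑ j ∈ Finset.range (k + 1),
          dividedPow j a * (expNeg s * dividedPow (k - j) s) := by
        rw [← hshift]
        refine setLIntegral_congr_fun measurableSet_Ioi fun s hs => ?_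
        simp only [add_sub_cancel_left, dividedPow_add ha (le_of_lt hs), Finset.mul_sum,
          mul_left_comm]
    _ = ∑ j ∈ Finset.range (k + 1), dividedPow j a := by
        rw [lintegral_finsetSum _ fun j _ => by fun_prop]
        refine Finset.sum_congr rfl fun j _ => ?_
        rw [lintegral_const_mul _ (by fun_prop), setLIntegral_Ioi_expNeg_mul_dividedPow, mul_one]

lemma ascentTransfer_dividedPow (k : ℕ) {a : ℝ} (ha : 0 ≤ a) :
    ascentTransfer (dividedPow k) a = ∑ j ∈ Finset.range (k + 2), dividedPow j a := by
  have hlow : ∫⁻ b in Ioc 0 a, expNeg (b - a)⁺ * dividedPow k b = dividedPow (k + 1) a := by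
    rw [← setLIntegral_Ioc_dividedPow k ha]
    refine setLIntegral_congr_fun measurableSet_Ioc fun b hb => ?_
    rw [posPart_of_nonpos (sub_nonpos.2 hb.2), expNeg_zero, one_mul]
  have hhigh : ∫⁻ b in Ioi a, expNeg (b - a)⁺ * dividedPow k b =
      ∑ j ∈ Finset.range (k + 1), dividedPow j a := by
    rw [← setLIntegral_Ioi_expNeg_sub_mul_dividedPow k ha]
    refine setLIntegral_congr_fun measurableSet_Ioi fun b hb => ?_
    rw [posPart_of_nonneg (sub_nonneg.2 (le_of_lt hb))]
  rw [ascentTransfer, ← Ioc_union_Ioi_eq_Ioi ha,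
    lintegral_union measurableSet_Ioi Ioc_disjoint_Ioi_same, hlow, hhigh,
    Finset.sum_range_succ _ (k + 1), add_comm]

/-- The polynomial `∑_{i ≤ n} c i * tⁱ / i!` with natural coefficients. -/
noncomputable def dividedPoly (c : ℕ → ℕ) (n : ℕ) (t : ℝ) : ℝ≥0∞ :=
  ∑ i ∈ Finset.range (n + 1), c i * dividedPow i t

lemma dividedPoly_succ (c : ℕ → ℕ) (n : ℕ) (t : ℝ) :
    dividedPoly c (n + 1) t =
      ∑ i ∈ Finset.range (n + 1), c (i + 1) * dividedPow (i + 1) t + c 0 := by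
  rw [dividedPoly, Finset.sum_range_succ', dividedPow_zero_left, mul_one]

lemma dividedPoly_zero_right (c : ℕ → ℕ) (n : ℕ) : dividedPoly c n 0 = c 0 := by
  rw [dividedPoly, Finset.sum_range_succ', Finset.sum_eq_zero fun i _ => by
    rw [dividedPow_zero_right i.succ_ne_zero, mul_zero]]
  simp

/-- A triangle of numbers in which each row is obtained from the previous one by taking tail sums:
`c (n + 1) (j + 1) = ∑_{j ≤ i ≤ n} c n i`. The tail sums are encoded by consecutive
differences, and the boundary entries `c (n + 1) 0` are free. -/
structure IsTailSumTriangle (c : ℕ → ℕ → ℕ) : Prop where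
  zero_zero : c 0 0 = 1
  succ_add_two : ∀ n, c (n + 1) (n + 2) = 0
  succ_succ : ∀ n j, j ≤ n → c (n + 1) (j + 1) = c n j + c (n + 1) (j + 2)

namespace IsTailSumTriangle

variable {c : ℕ → ℕ → ℕ}

lemma sum_Ico (hc : IsTailSumTriangle c) {n j : ℕ} (hj : j ≤ n + 1) :
    ∑ i ∈ Finset.Ico j (n + 1), c n i = c (n + 1) (j + 1) := by
  induction hj using Nat.decreasingInduction with
  | self => simp [hc.succ_add_two]
  | of_succ j hj ih =>
    rw [Finset.sum_eq_sum_Ico_succ_bot hj, ih, hc.succ_succ n j (Nat.le_of_lt_succ hj)]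

lemma ascentTransfer_dividedPoly (hc : IsTailSumTriangle c) (n : ℕ) {a : ℝ} (ha : 0 ≤ a) :
    ascentTransfer (dividedPoly (c n) n) a =
      ∑ j ∈ Finset.range (n + 1), c (n + 1) (j + 1) * dividedPow (j + 1) a + c (n + 1) 1 := by
  have hlinear : ascentTransfer (dividedPoly (c n) n) a =
      ∑ i ∈ Finset.range (n + 1), c n i * ascentTransfer (dividedPow i) a := by
    simp only [ascentTransfer, dividedPoly, Finset.mul_sum, mul_left_comm (expNeg _)]
    rw [lintegral_finsetSum _ fun j _ => by fun_prop]
    exact Finset.sum_congr rfl fun j _ => lintegral_const_mul _ (by fun_prop)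
  have hexchange : ∑ i ∈ Finset.range (n + 1), ∑ j ∈ Finset.range (i + 1),
      (c n i : ℝ≥0∞) * dividedPow (j + 1) a =
      ∑ j ∈ Finset.range (n + 1), ∑ i ∈ Finset.Ico j (n + 1), c n i * dividedPow (j + 1) a :=
    Finset.sum_comm' fun i j => by
      simp only [Finset.mem_range, Finset.mem_Ico]
      omega
  simp only [hlinear, ascentTransfer_dividedPow _ ha, Finset.sum_range_succ' _ (_ + 1), mul_add,
    Finset.sum_add_distrib, Finset.mul_sum, hexchange]
  congr 1
  · refine Finset.sum_congr rfl fun j hj => ?_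
    rw [← Finset.sum_mul, ← Nat.cast_sum, hc.sum_Ico (Finset.mem_range.1 hj).le]
  · rw [← hc.sum_Ico (Nat.zero_le _), Nat.Ico_zero_eq_range]
    simp

lemma dividedPoly_succ_eq_ascentTransfer_add (hc : IsTailSumTriangle c) {n r : ℕ}
    (hr : c (n + 1) 0 = c (n + 1) 1 + r) {a : ℝ} (ha : 0 ≤ a) :
    dividedPoly (c (n + 1)) (n + 1) a = ascentTransfer (dividedPoly (c n) n) a + r := by
  rw [dividedPoly_succ, hc.ascentTransfer_dividedPoly n ha, hr, Nat.cast_add, add_assoc]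

lemma shift (hc : IsTailSumTriangle c) : IsTailSumTriangle fun n j => c (n + 1) (j + 1) where
  zero_zero := by rw [hc.succ_succ 0 0 le_rfl, hc.zero_zero, hc.succ_add_two]
  succ_add_two n := hc.succ_add_two (n + 1)
  succ_succ n j hj := hc.succ_succ (n + 1) (j + 1) (Nat.succ_le_succ hj)

end IsTailSumTriangle

end AscentTransfer

section Triangles

/-- The binomial triangle whose `n`-th row lists the coefficients of `aʲ / j!` in the integral of
`exp (-ascent a x)` over the whole space. -/
def centralTriangle (n j : ℕ) : ℕ := (2 * n - j).choose n

/-- The triangle of ballot numbers, whose `n`-th row lists the coefficients of `aʲ / j!` in the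
integral of `exp (-ascent a x)` over the positive orthant. The difference of binomials never
truncates. -/
def ballotTriangle (n j : ℕ) : ℕ := (2 * n - j).choose n - (2 * n - j).choose (n + 1)

lemma isTailSumTriangle_centralTriangle : IsTailSumTriangle centralTriangle where
  zero_zero := rfl
  succ_add_two n := Nat.choose_eq_zero_of_lt (by omega)
  succ_succ n j hj := by
    obtain ⟨hleft, hright⟩ : 2 * (n + 1) - (j + 1) = 2 * n - j + 1 ∧
      2 * (n + 1) - (j + 2) = 2 * n - j := by omega
    rw [centralTriangle, hleft, Nat.choose_succ_succ, centralTriangle, centralTriangle, hright]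

lemma centralTriangle_succ_zero (n : ℕ) :
    centralTriangle (n + 1) 0 = centralTriangle (n + 1) 1 + centralTriangle (n + 1) 1 := by
  have hsymm : (2 * n + 1).choose n = (2 * n + 1).choose (n + 1) := Nat.choose_symm_half n |>.symm
  change (2 * n + 1 + 1).choose (n + 1) = (2 * n + 1).choose (n + 1) + (2 * n + 1).choose (n + 1)
  rw [Nat.choose_succ_succ, hsymm]

lemma choose_succ_le_choose {m k : ℕ} (h : m ≤ 2 * k + 1) : m.choose (k + 1) ≤ m.choose k := by
  refine Nat.le_of_mul_le_mul_right ?_ k.succ_pos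
  rw [Nat.succ_eq_add_one, Nat.choose_succ_right_eq]
  exact Nat.mul_le_mul_left _ (by omega)

lemma isTailSumTriangle_ballotTriangle : IsTailSumTriangle ballotTriangle where
  zero_zero := rfl
  succ_add_two n := by
    rw [ballotTriangle, Nat.choose_eq_zero_of_lt (by omega), Nat.zero_sub]
  succ_succ n j hj := by
    obtain ⟨hleft, hright⟩ : 2 * (n + 1) - (j + 1) = 2 * n - j + 1 ∧
      2 * (n + 1) - (j + 2) = 2 * n - j := by omega
    have hn : (2 * n - j).choose (n + 1) ≤ (2 * n - j).choose n := choose_succ_le_choose (by omega)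
    have hn' : (2 * n - j).choose (n + 2) ≤ (2 * n - j).choose (n + 1) :=
      choose_succ_le_choose (by omega)
    simp only [ballotTriangle, hleft, hright, Nat.choose_succ_succ', add_assoc, Nat.reduceAdd]
    omega

lemma ballotTriangle_succ_zero (n : ℕ) : ballotTriangle (n + 1) 0 = ballotTriangle (n + 1) 1 := by
  have hsymm : (2 * n + 1).choose n = (2 * n + 1).choose (n + 1) := Nat.choose_symm_half n |>.symm
  change (2 * n + 1 + 1).choose (n + 1) - (2 * n + 1 + 1).choose (n + 2) =
    (2 * n + 1).choose (n + 1) - (2 * n + 1).choose (n + 2)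
  rw [Nat.choose_succ_succ' (2 * n + 1) n, Nat.choose_succ_succ' (2 * n + 1) (n + 1), hsymm,
    Nat.add_sub_add_left]

lemma ballotTriangle_zero_right (n : ℕ) : ballotTriangle n 0 = catalan n := by
  refine Nat.eq_of_mul_eq_mul_left n.succ_pos ?_
  have hnext : (2 * n).choose (n + 1) * (n + 1) = (2 * n).choose n * n := by
    rw [Nat.choose_succ_right_eq]
    congr 1
    omega
  rw [Nat.succ_eq_add_one, succ_mul_catalan_eq_centralBinom, Nat.centralBinom, ballotTriangle,
    Nat.sub_zero, Nat.mul_sub, mul_comm _ ((2 * n).choose (n + 1)), hnext, add_mul, one_mul,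
    mul_comm n, Nat.add_sub_cancel_left]

end Triangles

section ProductIntegrals

lemma lintegral_pi_succ {n : ℕ} {α : Type*} [MeasurableSpace α] (ν : Measure α) [SigmaFinite ν]
    {F : (Fin (n + 1) → α) → ℝ≥0∞} (hF : Measurable F) :
    ∫⁻ x, F x ∂Measure.pi (fun _ => ν) =
      ∫⁻ b, ∫⁻ x, F (Fin.cons b x) ∂Measure.pi (fun _ : Fin n => ν) ∂ν := by
  have h := (measurePreserving_piFinSuccAbove (fun _ : Fin (n + 1) => ν) 0).symm
  rw [← h.lintegral_comp hF, lintegral_prod _ (by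
    exact (hF.comp (MeasurableEquiv.measurable _)).aemeasurable)]
  simp [MeasurableEquiv.piFinSuccAbove_symm_apply, Fin.insertNthEquiv]

lemma measurable_uncurry_comp_cons {α γ : Type*} [MeasurableSpace α] [MeasurableSpace γ] {n : ℕ}
    {F : (Fin (n + 1) → α) → γ} (hF : Measurable F) :
    Measurable fun p : α × (Fin n → α) => F (Fin.cons p.1 p.2) := by
  refine hF.comp (measurable_pi_lambda _ fun i => ?_)
  cases i using Fin.cases with
  | zero => simpa using measurable_fst
  | succ i => exact (measurable_pi_apply i).comp measurable_snd

lemma lintegral_pi_comp_mul_prod {α β : Type*} [MeasurableSpace α] [MeasurableSpace β]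
    {μ : Measure α} [SigmaFinite μ] {ν : Measure β} [SigmaFinite ν] {u : α → β} {w : α → ℝ≥0∞}
    (hu : Measurable u) (hw : Measurable w)
    (h : ∀ f : β → ℝ≥0∞, Measurable f → ∫⁻ b, f (u b) * w b ∂μ = ∫⁻ c, f c ∂ν)
    {n : ℕ} {F : (Fin n → β) → ℝ≥0∞} (hF : Measurable F) :
    ∫⁻ x, F (u ∘ x) * ∏ i, w (x i) ∂Measure.pi (fun _ => μ) =
      ∫⁻ y, F y ∂Measure.pi (fun _ => ν) := by
  induction n with
  | zero => simp [Measure.pi_of_empty _ isEmptyElim, Subsingleton.elim (u ∘ _) isEmptyElim]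
  | succ n ih =>
    have hintegrand {m : ℕ} {G : (Fin m → β) → ℝ≥0∞} (hG : Measurable G) :
        Measurable fun x : Fin m → α => G (u ∘ x) * ∏ i, w (x i) :=
      (hG.comp (by fun_prop)).mul (by fun_prop)
    have hcons := measurable_uncurry_comp_cons hF
    have hsection (c : β) : Measurable fun y : Fin n → β => F (Fin.cons c y) :=
      hcons.comp measurable_prodMk_left
    rw [lintegral_pi_succ ν hF, ← h _ hcons.lintegral_prod_right',
      lintegral_pi_succ μ (hintegrand hF)]
    refine lintegral_congr fun b => ?_
    rw [← ih (hsection _), ← lintegral_mul_const _ (hintegrand (hsection _))]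
    refine lintegral_congr fun x => ?_
    simp only [Fin.comp_cons, Fin.prod_univ_succ, Fin.cons_zero, Fin.cons_succ]
    ring

end ProductIntegrals

section AscentIntegral

lemma setLIntegral_Iic_eq_setLIntegral_Ioi_neg (c : ℝ) (F : ℝ → ℝ≥0∞) :
    ∫⁻ b in Iic c, F b = ∫⁻ b in Ioi (-c), F (-b) := by
  have hneg := (Measure.measurePreserving_neg (volume : Measure ℝ)).setLIntegral_comp_preimage_emb
    (MeasurableEquiv.neg ℝ).measurableEmbedding F (Iio c)
  rw [setLIntegral_congr Iio_ae_eq_Iic.symm, ← hneg, neg_preimage, neg_Iio]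

variable {n : ℕ} {a : ℝ}

lemma measurable_expNeg_ascent (a : ℝ) : Measurable fun x : Fin n → ℝ => expNeg (ascent a x) :=
  measurable_expNeg.comp (measurable_ascent a)

/-- The integral of `exp (-ascent)` over the walks starting at `a` whose `n` intermediate
positions are distributed according to the measure `ν`. -/
noncomputable def ascentIntegral (ν : Measure ℝ) (n : ℕ) (a : ℝ) : ℝ≥0∞ :=
  ∫⁻ x, expNeg (ascent a x) ∂Measure.pi fun _ : Fin n => ν

lemma ascentIntegral_zero (ν : Measure ℝ) [SigmaFinite ν] (ha : 0 ≤ a) :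
    ascentIntegral ν 0 a = 1 := by
  simp [ascentIntegral, negPart_of_nonneg ha]

lemma ascentIntegral_succ (ν : Measure ℝ) [SigmaFinite ν] (n : ℕ) (a : ℝ) :
    ascentIntegral ν (n + 1) a = ∫⁻ b, expNeg (b - a)⁺ * ascentIntegral ν n b ∂ν := by
  rw [ascentIntegral, lintegral_pi_succ ν (measurable_expNeg_ascent a)]
  simp only [ascent_cons, expNeg_add, lintegral_const_mul _ (measurable_expNeg_ascent _),
    ascentIntegral]

lemma ascentIntegral_volume_neg (n : ℕ) (a : ℝ) :
    ascentIntegral volume n (-a) = expNeg a * ascentIntegral volume n a := by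
  have hneg := (Measure.measurePreserving_neg (volume : Measure (Fin n → ℝ))).lintegral_comp
    (measurable_expNeg_ascent (-a))
  rw [ascentIntegral, ← volume_pi, ← hneg]
  simp only [ascent_neg, add_comm _ a, expNeg_add]
  rw [lintegral_const_mul _ (measurable_expNeg_ascent a), ascentIntegral, volume_pi]

lemma ascentIntegral_restrict_Ioi_succ (n : ℕ) (a : ℝ) :
    ascentIntegral (volume.restrict (Ioi 0)) (n + 1) a =
      ascentTransfer (ascentIntegral (volume.restrict (Ioi 0)) n) a :=
  ascentIntegral_succ _ n a

lemma ascentIntegral_restrict_Ioi_add_dirac_succ (n : ℕ) (ha : 0 ≤ a) :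
    ascentIntegral (volume.restrict (Ioi 0) + .dirac 0) (n + 1) a =
      ascentTransfer (ascentIntegral (volume.restrict (Ioi 0) + .dirac 0) n) a +
        ascentIntegral (volume.restrict (Ioi 0) + .dirac 0) n 0 := by
  rw [ascentIntegral_succ, lintegral_add_measure, lintegral_dirac,
    posPart_of_nonpos (by linarith : 0 - a ≤ 0), expNeg_zero, one_mul]
  rfl

/-- By the reflection `b ↦ -b`, a first step to a negative position contributes as much as a step
from `0` to a positive one. -/
lemma ascentIntegral_volume_succ (n : ℕ) (ha : 0 ≤ a) :
    ascentIntegral volume (n + 1) a =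
      ascentTransfer (ascentIntegral volume n) a + ascentTransfer (ascentIntegral volume n) 0 := by
  have hreflect : ∫⁻ b in Iic 0, expNeg (b - a)⁺ * ascentIntegral volume n b =
      ascentTransfer (ascentIntegral volume n) 0 := by
    rw [setLIntegral_Iic_eq_setLIntegral_Ioi_neg, neg_zero, ascentTransfer_zero_right]
    refine setLIntegral_congr_fun measurableSet_Ioi fun b hb => ?_
    have hb0 : 0 < b := hb
    rw [posPart_of_nonpos (by linarith), expNeg_zero, one_mul, ascentIntegral_volume_neg]
  rw [ascentIntegral_succ, ← lintegral_add_compl _ measurableSet_Ioi, compl_Ioi, hreflect]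
  rfl

lemma ascentIntegral_restrict_Ioi_eq_dividedPoly (n : ℕ) (ha : 0 ≤ a) :
    ascentIntegral (volume.restrict (Ioi 0)) n a = dividedPoly (ballotTriangle n) n a := by
  induction n generalizing a with
  | zero => simp [ascentIntegral_zero _ ha, dividedPoly, ballotTriangle]
  | succ n ih =>
    rw [ascentIntegral_restrict_Ioi_succ, ascentTransfer_congr (fun b hb => ih hb.le),
      isTailSumTriangle_ballotTriangle.dividedPoly_succ_eq_ascentTransfer_add (r := 0)
        (ballotTriangle_succ_zero n) ha, Nat.cast_zero, add_zero]

lemma ascentIntegral_restrict_Ioi_add_dirac_eq_dividedPoly (n : ℕ) (ha : 0 ≤ a) :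
    ascentIntegral (volume.restrict (Ioi 0) + .dirac 0) n a =
      dividedPoly (fun j => ballotTriangle (n + 1) (j + 1)) n a := by
  have hboundary : ∀ n, ballotTriangle (n + 2) 1 =
      ballotTriangle (n + 2) 2 + ballotTriangle (n + 1) 1 := fun n => by
    rw [isTailSumTriangle_ballotTriangle.succ_succ (n + 1) 0 (Nat.zero_le _),
      ballotTriangle_succ_zero, add_comm]
  induction n generalizing a with
  | zero => simp [ascentIntegral_zero _ ha, dividedPoly, ballotTriangle]
  | succ n ih =>
    rw [ascentIntegral_restrict_Ioi_add_dirac_succ n ha,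
      ascentTransfer_congr (fun b hb => ih hb.le), ih le_rfl, dividedPoly_zero_right]
    exact (isTailSumTriangle_ballotTriangle.shift.dividedPoly_succ_eq_ascentTransfer_add
      (hboundary n) ha).symm

lemma ascentIntegral_volume_eq_dividedPoly (n : ℕ) (ha : 0 ≤ a) :
    ascentIntegral volume n a = dividedPoly (centralTriangle n) n a := by
  have hc := isTailSumTriangle_centralTriangle
  induction n generalizing a with
  | zero => simp [ascentIntegral_zero _ ha, dividedPoly, centralTriangle]
  | succ n ih =>
    have hzero : ascentTransfer (dividedPoly (centralTriangle n) n) 0 =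
        centralTriangle (n + 1) 1 := by
      simp [hc.ascentTransfer_dividedPoly n le_rfl, dividedPow_zero_right]
    rw [ascentIntegral_volume_succ n ha, ascentTransfer_congr (fun b hb => ih hb.le),
      ascentTransfer_congr (fun b hb => ih hb.le), hzero,
      hc.dividedPoly_succ_eq_ascentTransfer_add (centralTriangle_succ_zero n) ha]

end AscentIntegral

section Volumes

lemma lintegral_posPart_mul_expNeg_negPart (f : ℝ → ℝ≥0∞) :
    ∫⁻ b, f b⁺ * expNeg b⁻ = ∫⁻ c, f c ∂(volume.restrict (Ioi 0) + .dirac 0) := by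
  have hpos : ∫⁻ b in Ioi 0, f b⁺ * expNeg b⁻ = ∫⁻ b in Ioi 0, f b :=
    setLIntegral_congr_fun measurableSet_Ioi fun b (hb : 0 < b) => by
      rw [posPart_of_nonneg hb.le, negPart_of_nonneg hb.le, expNeg_zero, mul_one]
  have hnonpos : ∫⁻ b in Iic 0, f b⁺ * expNeg b⁻ = f 0 := by
    rw [setLIntegral_Iic_eq_setLIntegral_Ioi_neg, neg_zero,
      setLIntegral_congr_fun measurableSet_Ioi fun b (hb : 0 < b) => by
        rw [posPart_neg, negPart_neg, negPart_of_nonneg hb.le, posPart_of_nonneg hb.le],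
      lintegral_const_mul _ measurable_expNeg, setLIntegral_congr Ioi_ae_eq_Ici,
      setLIntegral_Ici_expNeg, expNeg_zero, mul_one]
  rw [← lintegral_add_compl _ measurableSet_Ioi, compl_Ioi, hnonpos, hpos,
    lintegral_add_measure, lintegral_dirac]

variable {n : ℕ}

lemma expNeg_clusterGauge (x : Fin n → ℝ) :
    expNeg (clusterGauge x) = expNeg (ascent 0 x⁺) * ∏ i, expNeg (x i)⁻ := by
  rw [clusterGauge, expNeg_add, expNeg_sum]
  rfl

lemma lintegral_expNeg_clusterGauge :
    ∫⁻ x : Fin n → ℝ, expNeg (clusterGauge x) =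
      ascentIntegral (volume.restrict (Ioi 0) + .dirac 0) n 0 := by
  simp only [expNeg_clusterGauge]
  exact lintegral_pi_comp_mul_prod (u := (·⁺)) (by fun_prop) (by fun_prop)
    (fun f _ => lintegral_posPart_mul_expNeg_negPart f) (measurable_expNeg_ascent 0)

lemma volume_restrict_setOf_nonneg :
    (volume : Measure (Fin n → ℝ)).restrict {x | 0 ≤ x} =
      Measure.pi fun _ => volume.restrict (Ioi 0) := by
  have hpi : {x : Fin n → ℝ | 0 ≤ x} = univ.pi fun _ => Ici 0 := by
    ext x
    simp [Pi.le_def]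
  rw [hpi, volume_pi, Measure.restrict_pi_pi]
  simp only [restrict_Ioi_eq_restrict_Ici]

theorem integralVolume_polytopeC [NeZero n] :
    integralVolume (polytopeC n) = ((2 * n).choose n : ℝ≥0∞) := by
  rw [polytopeC_eq_setOf_ascent_le_one, ← univ_inter {x : Fin n → ℝ | ascent 0 x ≤ 1},
    integralVolume_inter_eq_lintegral_expNeg (measurable_ascent 0)
      (fun x _ => ascent_nonneg 0 x) (fun _ _ _ _ => mem_univ _)
      fun t ht => isSublinear_ascent_zero.map_smul t ht.le, setLIntegral_univ]
  exact (ascentIntegral_volume_eq_dividedPoly n le_rfl).trans (dividedPoly_zero_right _ n)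

theorem integralVolume_polytopeCclus [NeZero n] :
    integralVolume (polytopeCclus n) = (catalan (n + 1) : ℝ≥0∞) := by
  rw [polytopeCclus_eq_setOf_clusterGauge_le_one,
    ← univ_inter {x : Fin n → ℝ | clusterGauge x ≤ 1},
    integralVolume_inter_eq_lintegral_expNeg measurable_clusterGauge
      (fun x _ => clusterGauge_nonneg x) (fun _ _ _ _ => mem_univ _)
      fun t ht => isSublinear_clusterGauge.map_smul t ht.le, setLIntegral_univ,
    lintegral_expNeg_clusterGauge, ascentIntegral_restrict_Ioi_add_dirac_eq_dividedPoly n le_rfl,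
    dividedPoly_zero_right, ← ballotTriangle_succ_zero, ballotTriangle_zero_right]

theorem integralVolume_polytopeCplus (n : ℕ) :
    integralVolume (polytopeCplus n) = (catalan n : ℝ≥0∞) := by
  rw [polytopeCplus_eq_inter_setOf_ascent_le_one,
    integralVolume_inter_eq_lintegral_expNeg (K := {x : Fin n → ℝ | 0 ≤ x})
      (measurable_ascent 0) (fun x _ => ascent_nonneg 0 x)
      (fun t ht x (hx : 0 ≤ x) => show 0 ≤ t • x from smul_nonneg ht.le hx)
      fun t ht => isSublinear_ascent_zero.map_smul t ht.le,
    volume_restrict_setOf_nonneg, ← ballotTriangle_zero_right, ← dividedPoly_zero_right _ n]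
  exact ascentIntegral_restrict_Ioi_eq_dividedPoly n le_rfl

lemma catalan_eq_choose_div (n : ℕ) :
    (catalan n : ℝ≥0∞) = ((2 * n).choose n : ℝ≥0∞) / ((n : ℝ≥0∞) + 1) := by
  rw [ENNReal.eq_div_iff (by simp) (by finiteness)]
  exact_mod_cast succ_mul_catalan_eq_centralBinom n

end Volumes

end RootPolytopeA

theorem mainTheorem3 (n : ℕ) (hn : 1 ≤ n) :
    (RootPolytopeA.integralVolume (RootPolytopeA.polytopeC n)
        = ((2 * n).choose n : ℝ≥0∞) ∧
      RootPolytopeA.integralVolume (RootPolytopeA.polytopeC n)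
        = ((n : ℝ≥0∞) + 1) * (catalan n : ℝ≥0∞)) ∧
    (RootPolytopeA.integralVolume (RootPolytopeA.polytopeCclus n)
        = ((2 * n + 2).choose (n + 1) : ℝ≥0∞) / ((n : ℝ≥0∞) + 2) ∧
      RootPolytopeA.integralVolume (RootPolytopeA.polytopeCclus n)
        = (catalan (n + 1) : ℝ≥0∞)) ∧
    (RootPolytopeA.integralVolume (RootPolytopeA.polytopeCplus n)
        = ((2 * n).choose n : ℝ≥0∞) / ((n : ℝ≥0∞) + 1) ∧
      RootPolytopeA.integralVolume (RootPolytopeA.polytopeCplus n)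
        = (catalan n : ℝ≥0∞)) := by
  have : NeZero n := NeZero.of_pos hn
  rw [RootPolytopeA.integralVolume_polytopeC, RootPolytopeA.integralVolume_polytopeCclus,
    RootPolytopeA.integralVolume_polytopeCplus]
  refine ⟨⟨rfl, ?_⟩, ⟨?_, rfl⟩, RootPolytopeA.catalan_eq_choose_div n, rfl⟩
  · exact_mod_cast (succ_mul_catalan_eq_centralBinom n).symm
  · rw [RootPolytopeA.catalan_eq_choose_div, mul_add, mul_one, Nat.cast_succ, add_assoc,
      one_add_one_eq_two]
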